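/- Let $\mathcal H$ be a complex Hilbert space, $\rho_B$ a density operator on $\mathcal H$, and for each $t\in\mathbb R$ let $B(t)$ be a self-adjoint (possibly unbounded and possibly classically random) operator on $\mathcal H$ with finite second moment $\langle B(t)^2\rangle<\infty$. Here $\langle X\rangle=\langle \mathrm{Tr}(X\rho_B)\rangle_c$ combines the quantum expectation with the average $\langle\cdot\rangle_c$ over the classical randomness, $[X,Y]_\pm=XY\pm YX$, and $\langle B(t)B(t')\rangle$ is understood as $\big\langle\mathrm{Tr}\big((B(t)\sqrt{\rho_B})^\dagger B(t')\sqrt{\rho_B}\big)\big\rangle_c$. Call $(B,\rho_B)$ wide-sense stationary if $\langle B(t)\rangle$ is constant and $\langle B(t)B(t')\rangle=\langle B(t-t')B(0)\rangle$ for all $t,t'$. Fourier transforms are $\mathcal F[f](\omega)=\int_{\mathbb R}e^{-\mathrm i\omega t}f(t)\,dt$ and $\mathcal F^{-1}[F](t)=\frac1{2\pi}\int_{\mathbb R}e^{\mathrm i\omega t}F(\omega)\,d\omega$; such a transform is said to exist if the function is locally integrable and, at every argument, the integral converges at least as a symmetric improper integral $\lim_{R\to\infty}\int_{-R}^{R}$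 (in particular whenever the function is Lebesgue integrable). (a) Let $(B,\rho_B)$ be wide-sense stationary and suppose that the spectra $S^\pm=\mathcal F\big[\langle[B(t),B(0)]_\pm\rangle\big]$ exist. Then $S^\pm$ are real and $$|S^-(\omega)|\le S^+(\omega)\qquad\text{for all }\omega\in\mathbb R .$$ Moreover $$\big|\langle[B(t),B(t')]_-\rangle\big|\le\langle[B(0),B(0)]_+\rangle\qquad\text{for all }t,t'\in\mathbb R,$$ and for all $T_1,T_2\ge0$ $$2\Big|\int_{T_1}^{T_1+T_2}\!dt\int_0^{T_1}\!dt'\,\langle[B(t),B(t')]_-\rangle\Big|\le\Big(\int_0^{T_1}\!dt\int_0^{T_1}\!dt'+\int_0^{T_2}\!dt\int_0^{T_2}\!dt'\Big)\langle[B(t),B(t')]_+\rangle .$$ (b) Conversely, let $\hat S^+,\hat S^-:\mathbb R\to\mathbb R$ be respectively symmetric and antisymmetric, with $|\hat S^-(\omega)|\le\hat S^+(\omega)$ for all $\omega\in\mathbb R$, and suppose that $\mathcal F^{-1}[\hat S^\pm]$ exist. Then there are a Hilbert space $\hat{\mathcal H}$, a density operator $\hat\rho_B$ and operators $\hat B(t)$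 as above such that $(\hat B,\hat\rho_B)$ is wide-sense stationary with mean zero and has the spectra $\hat S^\pm$, that is, $\langle[\hat B(t),\hat B(0)]_\pm\rangle=\mathcal F^{-1}[\hat S^\pm](t)$ for all $t$. Consequently $\mathcal F\big[\langle[\hat B(t),\hat B(0)]_\pm\rangle\big]=\hat S^\pm$ in the sense of tempered distributions, and also at every $\omega\in\mathbb R$, for each of the two signs for which $\langle[\hat B(t),\hat B(0)]_\pm\rangle$ is integrable in $t$ and $\hat S^\pm$ is continuous. -/

import Mathlib

open MeasureTheory Filter Topology
open scoped ComplexOrder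

noncomputable section

/-- A possibly unbounded operator applied to a vector, with the value `0` outside the domain. -/
def pmapApply {H : Type*} [NormedAddCommGroup H] [InnerProductSpace ℂ H]
    (A : H →ₗ.[ℂ] H) (x : H) : H := by
  classical
  exact if h : x ∈ A.domain then A ⟨x, h⟩ else 0

/-- Index set of a fixed orthonormal (Hilbert) basis of `H`. -/
def BasisIndex (H : Type*) [NormedAddCommGroup H] [InnerProductSpace ℂ H] [CompleteSpace H] :
    Set H :=
  (exists_hilbertBasis ℂ H).choose

/-- A fixed orthonormal (Hilbert) basis of `H`, used to write traces. All traces below are traces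
of trace-class operators, so they do not depend on the basis. -/
def onb (H : Type*) [NormedAddCommGroup H] [InnerProductSpace ℂ H] [CompleteSpace H] :
    HilbertBasis (BasisIndex H) ℂ H :=
  (exists_hilbertBasis ℂ H).choose_spec.choose

/-- Density operators: positive operators of trace one. -/
structure IsDensityOperator {H : Type*} [NormedAddCommGroup H] [InnerProductSpace ℂ H]
    [CompleteSpace H] (ρ : H →L[ℂ] H) : Prop where
  isPositive : ρ.IsPositive
  trace_eq_one : HasSum (fun i => inner ℂ (onb H i) (ρ (onb H i))) 1

/-- The vectors `√ρ eᵢ`, where `(eᵢ)` is the fixed orthonormal basis. -/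
def sqrtVec {H : Type*} [NormedAddCommGroup H] [InnerProductSpace ℂ H] [CompleteSpace H]
    (ρ : H →L[ℂ] H) (i : BasisIndex H) : H :=
  CFC.sqrt ρ (onb H i)

/-- A bath on the Hilbert space `H`, subject to classical randomness on the probability space
`(Ω, P)`: a state `ρ` and, for every time, a random self-adjoint (possibly unbounded) operator
`B(t)` with finite second moment `⟨Tr (B(t)² ρ)⟩_c = ⟨‖B(t) √ρ‖²⟩_c`
(squared Hilbert--Schmidt norm). -/
structure Bath (H : Type*) [NormedAddCommGroup H] [InnerProductSpace ℂ H] [CompleteSpace H]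
    {Ω : Type*} [MeasurableSpace Ω] (P : Measure Ω) where
  /-- the bath state -/
  ρ : H →L[ℂ] H
  /-- the bath operator -/
  B : ℝ → Ω → H →ₗ.[ℂ] H
  density : IsDensityOperator ρ
  selfAdjoint : ∀ t w, IsSelfAdjoint (B t w)
  mem_domain : ∀ t, ∀ᵐ w ∂P, ∀ x, CFC.sqrt ρ x ∈ (B t w).domain
  measurable : ∀ t x, AEStronglyMeasurable (fun w => pmapApply (B t w) (CFC.sqrt ρ x)) P
  secondMoment : ∀ t, ∫⁻ w, ∑' i, ‖pmapApply (B t w) (sqrtVec ρ i)‖ₑ ^ 2 ∂P < ⊤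

namespace Bath

variable {H : Type*} [NormedAddCommGroup H] [InnerProductSpace ℂ H] [CompleteSpace H]
  {Ω : Type*} [MeasurableSpace Ω] {P : Measure Ω}

/-- The mean `⟨B(t)⟩ = ⟨Tr (B(t) ρ)⟩_c`, the trace being written as
`∑ᵢ ⟪√ρ eᵢ, B(t) √ρ eᵢ⟫`. -/
def mean (b : Bath H P) (t : ℝ) : ℂ :=
  ∫ w, ∑' i, inner ℂ (sqrtVec b.ρ i) (pmapApply (b.B t w) (sqrtVec b.ρ i)) ∂P

/-- The correlation function `⟨B(t) B(t')⟩ = ⟨Tr (B(t) B(t') ρ)⟩_c`. As `B(t)` is self-adjoint,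
`Tr (B(t) B(t') ρ) = Tr ((B(t) √ρ)† (B(t') √ρ)) = ∑ᵢ ⟪B(t) √ρ eᵢ, B(t') √ρ eᵢ⟫`; this form
also makes sense for unbounded operators. -/
def corr (b : Bath H P) (t t' : ℝ) : ℂ :=
  ∫ w, ∑' i, inner ℂ (pmapApply (b.B t w) (sqrtVec b.ρ i))
    (pmapApply (b.B t' w) (sqrtVec b.ρ i)) ∂P

/-- The classical correlation function `⟨[B(t), B(t')]₊⟩ = ⟨B(t) B(t')⟩ + ⟨B(t') B(t)⟩`. -/
def anticommCorr (b : Bath H P) (t t' : ℝ) : ℂ := b.corr t t' + b.corr t' t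

/-- The quantum correlation function `⟨[B(t), B(t')]₋⟩ = ⟨B(t) B(t')⟩ - ⟨B(t') B(t)⟩`. -/
def commCorr (b : Bath H P) (t t' : ℝ) : ℂ := b.corr t t' - b.corr t' t

/-- Wide-sense stationarity: constant mean, and correlations depending only on `t - t'`. -/
structure IsWideSenseStationary (b : Bath H P) : Prop where
  mean_eq : ∀ t, b.mean t = b.mean 0
  corr_eq : ∀ t t', b.corr t t' = b.corr (t - t') 0

end Bath

/-- `f` has at every frequency `ω` a Fourier transform `F ω = ∫ exp (-i ω t) f(t) dt`, the integral
converging at least as a symmetric improper integral (so every Lebesgue integrable `f` has one). -/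
structure HasFourier (f F : ℝ → ℂ) : Prop where
  locallyIntegrable : LocallyIntegrable f volume
  tendsto : ∀ ω : ℝ, Tendsto
    (fun R : ℝ => ∫ t in (-R)..R, Complex.exp (-(Complex.I * ω * t)) * f t) atTop (𝓝 (F ω))

/-- `F` has at every time `t` an inverse Fourier transform
`f t = (2π)⁻¹ ∫ exp (i ω t) F(ω) dω`, again at least as a symmetric improper integral. -/
structure HasFourierInv (F f : ℝ → ℂ) : Prop where
  locallyIntegrable : LocallyIntegrable F volume
  tendsto : ∀ t : ℝ, Tendsto
    (fun R : ℝ => (1 / (2 * Real.pi) : ℂ) *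
      ∫ ω in (-R)..R, Complex.exp (Complex.I * ω * t) * F ω) atTop (𝓝 (f t))

/-- The (bounded) function `f` has the function `F` as its Fourier transform in the sense of
tempered distributions. -/
def HasTemperedFourier (f F : ℝ → ℂ) : Prop :=
  ∀ φ : SchwartzMap ℝ ℂ,
    ∫ t : ℝ, f t * (∫ ω : ℝ, Complex.exp (-(Complex.I * ω * t)) * φ ω) = ∫ ω : ℝ, F ω * φ ω

end

open ComplexConjugate InnerProductSpace
open scoped FourierTransform

/-! Part (a). The family `(B(t) √ρ eᵢ)ᵢ` is a vector `vec t` of a Hilbert space, and the correlation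
function is its Gram kernel (`corr_eq_inner_vec`). Stationarity makes `f t = ⟨B(t) B(0)⟩` positive
definite: Hermitian, bounded by `f 0`, and with nonnegative integrals of `Re (conj (g t) * g t' * f
(t - t'))` over squares for every measurable unimodular `g` (`integral_weighted_nonneg`). Neither
`f` nor `vec` is assumed continuous, and `vec` need not be measurable, so this last point is proved
by random sampling.

For `g t = exp (i ω t)` the square integral is the integral over `r` in `[0, R]` of the symmetric
truncations `∫ s in -r..r, exp (-i ω s) f s`; if these converge, the limit is nonnegative
(`fourier_nonneg`), the easy half of Bochner's theorem. Since `S⁺(ω) ± S⁻(ω)` is twice the transform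
of `f` at `±ω`, the bound `|S⁻| ≤ S⁺` follows. The pointwise commutator bound is Cauchy–Schwarz, and
the double-integral bound comes from `g` equal to `1` on the first interval and to `±i` on the
second (`cross_nonneg`).

Part (b). The function `(S⁺ + S⁻) / 4π` is nonnegative and integrable, hence up to its mass the law
of a random frequency `ω`. A two-level system in its ground state, with a coupling rotating at
frequency `ω`, has this function as spectral density (`twoLevelBath_corr`). Its even and odd parts
give the prescribed correlations, and Fourier inversion gives the remaining claims. -/

theorem pmapApply_zero {H : Type*} [NormedAddCommGroup H] [InnerProductSpace ℂ H]
    (A : H →ₗ.[ℂ] H) : pmapApply A 0 = 0 := by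
  unfold pmapApply
  rw [dif_pos A.domain.zero_mem]
  exact A.map_zero

/-! ### The correlation function as a Gram kernel -/

namespace Bath

variable {H : Type*} [NormedAddCommGroup H] [InnerProductSpace ℂ H] [CompleteSpace H]
  {Ω : Type*} [MeasurableSpace Ω] {P : Measure Ω}

theorem inner_density_eq (b : Bath H P) (i : BasisIndex H) :
    inner ℂ (onb H i) (b.ρ (onb H i)) = inner ℂ (sqrtVec b.ρ i) (sqrtVec b.ρ i) := by
  have hρ : 0 ≤ b.ρ := (ContinuousLinearMap.nonneg_iff_isPositive _).2 b.density.isPositive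
  have hs : (CFC.sqrt b.ρ).IsPositive :=
    (ContinuousLinearMap.nonneg_iff_isPositive _).1 (CFC.sqrt_nonneg b.ρ)
  conv_lhs => rw [← CFC.sqrt_mul_sqrt_self b.ρ hρ]
  rw [mul_apply_eq_comp]
  exact (hs.isSymmetric (onb H i) (CFC.sqrt b.ρ (onb H i))).symm

/-- The trace of `ρ` is the sum of `‖√ρ eᵢ‖²`, and a convergent sum has only countably many nonzero
terms. The basis may be uncountable, so this is what permits exchanging sums with integrals. -/
theorem countable_support_sqrtVec (b : Bath H P) : {i | sqrtVec b.ρ i ≠ 0}.Countable := by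
  have h := b.density.trace_eq_one.summable.countable_support
  refine h.mono fun i hi => ?_
  simpa [Function.mem_support, inner_density_eq] using hi

theorem lintegral_enorm_sq_lt_top (b : Bath H P) (t : ℝ) :
    ∑' i : {i | sqrtVec b.ρ i ≠ 0}, ∫⁻ w, ‖pmapApply (b.B t w) (sqrtVec b.ρ i)‖ₑ ^ 2 ∂P < ⊤ := by
  have : Countable {i | sqrtVec b.ρ i ≠ 0} := b.countable_support_sqrtVec
  rw [← lintegral_tsum (f := fun (i : {i | sqrtVec b.ρ i ≠ 0}) w =>
    ‖pmapApply (b.B t w) (sqrtVec b.ρ i)‖ₑ ^ 2)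
    fun i => (b.measurable t (onb H i)).enorm.pow_const 2]
  refine lt_of_le_of_lt (lintegral_mono fun w => ?_) (b.secondMoment t)
  exact ENNReal.tsum_comp_le_tsum_of_injective Subtype.val_injective
    (fun i => ‖pmapApply (b.B t w) (sqrtVec b.ρ i)‖ₑ ^ 2)

theorem memLp_apply_sqrtVec (b : Bath H P) (t : ℝ) (i : {i | sqrtVec b.ρ i ≠ 0}) :
    MemLp (fun w => pmapApply (b.B t w) (sqrtVec b.ρ i)) 2 P := by
  refine ⟨b.measurable t (onb H i), ?_⟩
  rw [eLpNorm_lt_top_iff_lintegral_rpow_enorm_lt_top two_ne_zero ENNReal.ofNat_ne_top]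
  simpa using (ENNReal.le_tsum i).trans_lt (b.lintegral_enorm_sq_lt_top t)

/-- The vector `B(t) √ρ eᵢ` as a square-integrable random vector. -/
noncomputable def component (b : Bath H P) (t : ℝ) (i : {i | sqrtVec b.ρ i ≠ 0}) : Lp H 2 P :=
  (b.memLp_apply_sqrtVec t i).toLp

theorem norm_component_sq (b : Bath H P) (t : ℝ) (i : {i | sqrtVec b.ρ i ≠ 0}) :
    ‖b.component t i‖ ^ 2 =
      (∫⁻ w, ‖pmapApply (b.B t w) (sqrtVec b.ρ i)‖ₑ ^ 2 ∂P).toReal := by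
  rw [component, Lp.norm_toLp, eLpNorm_eq_lintegral_rpow_enorm_toReal two_ne_zero ENNReal.ofNat_ne_top,
    ← ENNReal.toReal_pow, ← ENNReal.rpow_natCast, ← ENNReal.rpow_mul]
  simp

theorem summable_norm_component_sq (b : Bath H P) (t : ℝ) :
    Summable fun i => ‖b.component t i‖ ^ 2 := by
  simp_rw [norm_component_sq]
  exact ENNReal.summable_toReal (b.lintegral_enorm_sq_lt_top t).ne

/-- The family `(B(t) √ρ eᵢ)ᵢ`, a vector of a Hilbert space. -/
noncomputable def vec (b : Bath H P) (t : ℝ) :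
    lp (fun _ : {i | sqrtVec b.ρ i ≠ 0} => Lp H 2 P) 2 :=
  ⟨fun i => b.component t i, by
    refine memℓp_gen ?_
    simpa using b.summable_norm_component_sq t⟩

theorem inner_component (b : Bath H P) (t t' : ℝ) (i : {i | sqrtVec b.ρ i ≠ 0}) :
    inner ℂ (b.component t i) (b.component t' i) =
      ∫ w, inner ℂ (pmapApply (b.B t w) (sqrtVec b.ρ i))
        (pmapApply (b.B t' w) (sqrtVec b.ρ i)) ∂P := by
  rw [L2.inner_def]
  refine integral_congr_ae ?_
  filter_upwards [(b.memLp_apply_sqrtVec t i).coeFn_toLp,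
    (b.memLp_apply_sqrtVec t' i).coeFn_toLp] with w h h'
  simp only [component, h, h']

theorem integrable_inner (b : Bath H P) (t t' : ℝ) (i : {i | sqrtVec b.ρ i ≠ 0}) :
    Integrable (fun w => inner ℂ (pmapApply (b.B t w) (sqrtVec b.ρ i))
      (pmapApply (b.B t' w) (sqrtVec b.ρ i))) P := by
  refine (L2.integrable_inner (𝕜 := ℂ) (b.component t i) (b.component t' i)).congr ?_
  filter_upwards [(b.memLp_apply_sqrtVec t i).coeFn_toLp,
    (b.memLp_apply_sqrtVec t' i).coeFn_toLp] with w h h'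
  simp only [component, h, h']

theorem integral_norm_inner_le (b : Bath H P) (t t' : ℝ) (i : {i | sqrtVec b.ρ i ≠ 0}) :
    ∫ w, ‖inner ℂ (pmapApply (b.B t w) (sqrtVec b.ρ i))
        (pmapApply (b.B t' w) (sqrtVec b.ρ i))‖ ∂P ≤
      ‖b.component t i‖ ^ 2 + ‖b.component t' i‖ ^ 2 := by
  have key : ∀ s, ‖b.component s i‖ ^ 2 = ∫ w, ‖pmapApply (b.B s w) (sqrtVec b.ρ i)‖ ^ 2 ∂P := by
    intro s
    have h := b.inner_component s s i
    simp_rw [inner_self_eq_norm_sq_to_K] at h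
    have h2 : ((‖b.component s i‖ ^ 2 : ℝ) : ℂ) =
        ((∫ w, ‖pmapApply (b.B s w) (sqrtVec b.ρ i)‖ ^ 2 ∂P : ℝ) : ℂ) := by
      rw [← integral_complex_ofReal]
      simpa using h
    exact_mod_cast h2
  have hi := fun s => (b.memLp_apply_sqrtVec s i).integrable_norm_pow two_ne_zero
  rw [key, key, ← integral_add (by simpa using hi t) (by simpa using hi t')]
  refine integral_mono_of_nonneg (ae_of_all _ fun w => norm_nonneg _)
    ((hi t).add (hi t')) (ae_of_all _ fun w => ?_)
  have := norm_inner_le_norm (𝕜 := ℂ) (pmapApply (b.B t w) (sqrtVec b.ρ i))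
        (pmapApply (b.B t' w) (sqrtVec b.ρ i))
  nlinarith [sq_nonneg (‖pmapApply (b.B t w) (sqrtVec b.ρ i)‖ -
    ‖pmapApply (b.B t' w) (sqrtVec b.ρ i)‖), sq_nonneg (‖pmapApply (b.B t w) (sqrtVec b.ρ i)‖),
    sq_nonneg (‖pmapApply (b.B t' w) (sqrtVec b.ρ i)‖)]

/-- The finite second moments dominate the terms, so sum and integral can be exchanged; indices with
`√ρ eᵢ = 0` contribute nothing. -/
theorem corr_eq_inner_vec (b : Bath H P) (t t' : ℝ) : b.corr t t' = inner ℂ (b.vec t) (b.vec t') := by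
  have : Countable {i | sqrtVec b.ρ i ≠ 0} := b.countable_support_sqrtVec
  have h := hasSum_integral_of_summable_integral_norm (μ := P)
    (F := fun (i : {i | sqrtVec b.ρ i ≠ 0}) w =>
      inner ℂ (pmapApply (b.B t w) (sqrtVec b.ρ i)) (pmapApply (b.B t' w) (sqrtVec b.ρ i)))
    (fun i => b.integrable_inner t t' i)
    (Summable.of_nonneg_of_le (fun i => integral_nonneg fun w => norm_nonneg _)
      (b.integral_norm_inner_le t t')
      ((b.summable_norm_component_sq t).add (b.summable_norm_component_sq t')))
  have h2 := lp.hasSum_inner (𝕜 := ℂ) (b.vec t) (b.vec t')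
  have h3 : (fun i => inner ℂ (b.vec t i) (b.vec t' i)) = fun i : {i | sqrtVec b.ρ i ≠ 0} =>
      ∫ w, inner ℂ (pmapApply (b.B t w) (sqrtVec b.ρ i))
        (pmapApply (b.B t' w) (sqrtVec b.ρ i)) ∂P := funext fun i => b.inner_component t t' i
  rw [h3] at h2
  rw [h2.unique h, corr]
  refine integral_congr_ae (ae_of_all _ fun w => ?_)
  refine (tsum_subtype_eq_of_support_subset (s := {i | sqrtVec b.ρ i ≠ 0}) (f := fun i => inner ℂ
    (pmapApply (b.B t w) (sqrtVec b.ρ i)) (pmapApply (b.B t' w) (sqrtVec b.ρ i)))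
    fun i hi (h0 : sqrtVec b.ρ i = 0) => hi ?_).symm
  simp [h0, pmapApply_zero]

end Bath

/-! ### Integrated positivity of Gram kernels, without measurability of the vectors -/

section IntegratedPositivity

variable {α E : Type*} [MeasurableSpace α] [NormedAddCommGroup E] [InnerProductSpace ℂ E]

/-- Distinct coordinates are independent, so their joint law is the product law. -/
theorem measurePreserving_pair_pi (μ : Measure α) [IsProbabilityMeasure μ] {n : ℕ} {k l : Fin n}
    (hkl : k ≠ l) :
    MeasurePreserving (fun x : Fin n → α => (x k, x l)) (Measure.pi fun _ => μ) (μ.prod μ) := by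
  have hk := measurePreserving_eval (fun _ : Fin n => μ) k
  have hl := measurePreserving_eval (fun _ : Fin n => μ) l
  have hi := (ProbabilityTheory.iIndepFun_pi (μ := fun _ : Fin n => μ) (X := fun _ x => x)
    (fun _ => aemeasurable_id)).indepFun hkl
  refine ⟨by fun_prop, ?_⟩
  have := (ProbabilityTheory.indepFun_iff_map_prod_eq_prod_map_map
    hk.measurable.aemeasurable hl.measurable.aemeasurable).1 hi
  rw [hk.map_eq, hl.map_eq] at this
  exact this

/-- Integrated positivity of a bounded Gram kernel, for a probability measure: average the
positivity for `n` independent random points and let `n` tend to infinity. -/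
theorem integral_re_inner_nonneg_of_isProbabilityMeasure (μ : Measure α) [IsProbabilityMeasure μ]
    (v : α → E) {M : ℝ} (hM : ∀ x, ‖v x‖ ^ 2 ≤ M)
    (hK : Integrable (fun p : α × α => (inner ℂ (v p.1) (v p.2)).re) (μ.prod μ))
    (hd : AEStronglyMeasurable (fun x => (inner ℂ (v x) (v x)).re) μ) :
    0 ≤ ∫ p, (inner ℂ (v p.1) (v p.2)).re ∂μ.prod μ := by
  set I := ∫ p, (inner ℂ (v p.1) (v p.2)).re ∂μ.prod μ with hI
  have hdiag : ∀ x, (inner ℂ (v x) (v x)).re ≤ M := fun x => by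
    have := hM x
    rwa [← inner_self_eq_norm_sq (𝕜 := ℂ)] at this
  have hnn : ∀ x, 0 ≤ (inner ℂ (v x) (v x)).re := fun x => inner_self_nonneg (𝕜 := ℂ)
  have hdint : Integrable (fun x => (inner ℂ (v x) (v x)).re) μ :=
    Integrable.of_bound hd M (ae_of_all _ fun x => by
      rw [Real.norm_eq_abs, abs_of_nonneg (hnn x)]; exact hdiag x)
  have key : ∀ n : ℕ, 0 ≤ n * M + (n * n - n) * I := by
    intro n
    have hterm : ∀ k l : Fin n, Integrable (fun x : Fin n → α => (inner ℂ (v (x k)) (v (x l))).re)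
        (Measure.pi fun _ => μ) ∧
        ∫ x : Fin n → α, (inner ℂ (v (x k)) (v (x l))).re ∂(Measure.pi fun _ => μ) ≤
          if k = l then M else I := by
      intro k l
      by_cases hkl : k = l
      · subst hkl
        have hk := measurePreserving_eval (fun _ : Fin n => μ) k
        refine ⟨hk.integrable_comp_of_integrable hdint, ?_⟩
        rw [if_pos rfl]
        have h1 : ∫ x : Fin n → α, (inner ℂ (v (x k)) (v (x k))).re ∂(Measure.pi fun _ => μ) ≤
            ∫ x : Fin n → α, M ∂(Measure.pi fun _ => μ) :=
          integral_mono (hk.integrable_comp_of_integrable hdint) (integrable_const _)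
            fun x => hdiag _
        simpa using h1
      · have hp := measurePreserving_pair_pi μ hkl
        refine ⟨hp.integrable_comp_of_integrable hK, ?_⟩
        rw [if_neg hkl, hI, ← hp.map_eq, integral_map hp.measurable.aemeasurable
          (by rw [hp.map_eq]; exact hK.1)]
    -- The double sum is `‖∑ v (x k)‖²`. Its `n` diagonal terms have mean at most `M`, its `n² - n`
    -- other terms have mean `I`. Only scalar functions are integrated.
    have hpos : 0 ≤ ∫ x : Fin n → α, ∑ k, ∑ l, (inner ℂ (v (x k)) (v (x l))).re
        ∂(Measure.pi fun _ => μ) := by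
      refine integral_nonneg fun x => ?_
      have h := inner_self_nonneg (𝕜 := ℂ) (x := ∑ k, v (x k))
      rw [sum_inner] at h
      simp_rw [inner_sum] at h
      simpa using h
    rw [integral_finsetSum _ fun k _ => integrable_finsetSum _ fun l _ => (hterm k l).1] at hpos
    simp_rw [integral_finsetSum _ fun l _ => (hterm _ l).1] at hpos
    refine hpos.trans ((Finset.sum_le_sum fun k _ => Finset.sum_le_sum fun l _ =>
      (hterm k l).2).trans (le_of_eq ?_))
    have : ∀ k l : Fin n, (if k = l then M else I) = (if k = l then M - I else 0) + I := by
      intro k l; split_ifs <;> ring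
    simp_rw [this, Finset.sum_add_distrib]
    simp
    ring
  by_contra hneg
  push Not at hneg
  -- `key (n + 1)` amounts to `0 ≤ M + n * I`, which fails for large `n` when `I < 0`.
  obtain ⟨n, hn⟩ := exists_nat_gt (M / (-I) + 1)
  have h1 := key (n + 1)
  have h2 : M < (n - 1) * (-I) := by
    rw [← div_lt_iff₀ (by linarith)]; linarith
  push_cast at h1
  have h3 : (0:ℝ) ≤ n := n.cast_nonneg
  nlinarith

/-- Integrated positivity of a bounded Gram kernel. -/
theorem integral_re_inner_nonneg (μ : Measure α) [IsFiniteMeasure μ]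
    (v : α → E) {M : ℝ} (hM : ∀ x, ‖v x‖ ^ 2 ≤ M)
    (hK : Integrable (fun p : α × α => (inner ℂ (v p.1) (v p.2)).re) (μ.prod μ))
    (hd : AEStronglyMeasurable (fun x => (inner ℂ (v x) (v x)).re) μ) :
    0 ≤ ∫ p, (inner ℂ (v p.1) (v p.2)).re ∂μ.prod μ := by
  rcases eq_zero_or_neZero μ with rfl | hμ
  · simp
  set c := (μ Set.univ)⁻¹ with hc
  have hc0 : c ≠ 0 := ENNReal.inv_ne_zero.2 (measure_ne_top _ _)
  have hct : c ≠ ⊤ := ENNReal.inv_ne_top.2 (by simpa using hμ.out)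
  have hprod : (c • μ).prod (c • μ) = (c * c) • μ.prod μ := by
    rw [Measure.prod_smul_left, Measure.prod_smul_right, smul_smul]
  have h := integral_re_inner_nonneg_of_isProbabilityMeasure (c • μ) v hM
    (by rw [hprod]; exact hK.smul_measure (ENNReal.mul_ne_top hct hct))
    (hd.mono_ac (Measure.smul_absolutelyContinuous))
  rw [hprod, integral_smul_measure, smul_eq_mul] at h
  refine nonneg_of_mul_nonneg_right h ?_
  exact ENNReal.toReal_pos (mul_ne_zero hc0 hc0) (ENNReal.mul_ne_top hct hct)

end IntegratedPositivity

/-! ### Integrals of difference kernels and averages of truncated integrals -/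

theorem intervalIntegrable_of_locallyIntegrable {F : Type*} [NormedAddCommGroup F] {φ : ℝ → F}
    (hφ : LocallyIntegrable φ volume) (a b : ℝ) : IntervalIntegrable φ volume a b :=
  (hφ.integrableOn_isCompact isCompact_uIcc).intervalIntegrable

theorem intervalIntegral_congr_of_mem_Ioc {f g : ℝ → ℝ} {a b : ℝ} (hab : a ≤ b)
    (h : ∀ x ∈ Set.Ioc a b, f x = g x) : ∫ x in a..b, f x = ∫ x in a..b, g x := by
  rw [intervalIntegral.integral_of_le hab, intervalIntegral.integral_of_le hab]
  exact setIntegral_congr_fun measurableSet_Ioc h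

/-- After substituting `s = t - t'`, the variable `t` enters only through the endpoints of a
primitive, so `φ` itself need not be continuous. -/
theorem continuous_intervalIntegral_sub {φ : ℝ → ℝ} (hφ : LocallyIntegrable φ volume) (c d : ℝ) :
    Continuous fun t => ∫ t' in c..d, φ (t - t') := by
  have hint : ∀ a b, IntervalIntegrable φ volume a b := 
    intervalIntegrable_of_locallyIntegrable hφ
  have hc := intervalIntegral.continuous_primitive hint 0
  have : (fun t => ∫ t' in c..d, φ (t - t')) =
      fun t => (∫ s in (0 : ℝ)..(t - c), φ s) - ∫ s in (0 : ℝ)..(t - d), φ s := by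
    funext t
    rw [intervalIntegral.integral_comp_sub_left, intervalIntegral.integral_interval_sub_left
      (hint _ _) (hint _ _)]
  rw [this]
  exact (hc.comp (continuous_id.sub continuous_const)).sub
    (hc.comp (continuous_id.sub continuous_const))

/-- The integral of a difference kernel over a square, in terms of symmetric integrals. -/
theorem integral_integral_sub_eq {h : ℝ → ℝ} (hh : LocallyIntegrable h volume) (R : ℝ) :
    ∫ t in (0 : ℝ)..R, ∫ t' in (0 : ℝ)..R, h (t - t') = ∫ r in (0 : ℝ)..R, ∫ s in (-r)..r, h s := by
  have hint : ∀ a b, IntervalIntegrable h volume a b := 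
    intervalIntegrable_of_locallyIntegrable hh
  have hc := intervalIntegral.continuous_primitive hint 0
  have hneg : ∀ u, ∫ s in u..0, h s = -∫ s in (0 : ℝ)..u, h s := fun u =>
    intervalIntegral.integral_symm _ _
  have h1 : ∀ t, ∫ t' in (0 : ℝ)..R, h (t - t') =
      (∫ s in (t - R)..0, h s) + ∫ s in (0 : ℝ)..t, h s := fun t => by
    rw [intervalIntegral.integral_comp_sub_left, sub_zero,
      intervalIntegral.integral_add_adjacent_intervals (hint _ _) (hint _ _)]
  have h2 : ∀ r, ∫ s in (-r)..r, h s = (∫ s in (-r)..0, h s) + ∫ s in (0 : ℝ)..r, h s := fun r => by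
    rw [intervalIntegral.integral_add_adjacent_intervals (hint _ _) (hint _ _)]
  simp_rw [h1, h2]
  have hc1 : Continuous fun t => ∫ s in (t - R)..0, h s := by
    simp_rw [hneg]
    exact (hc.comp (continuous_id.sub continuous_const)).neg
  have hc2 : Continuous fun t => ∫ s in (-t)..0, h s := by
    simp_rw [hneg]
    exact (hc.comp continuous_neg).neg
  rw [intervalIntegral.integral_add (hc1.intervalIntegrable _ _) (hc.intervalIntegrable _ _),
    intervalIntegral.integral_add (hc2.intervalIntegrable _ _) (hc.intervalIntegrable _ _)]
  -- The contributions of `s > 0` agree; for `s < 0` the reflection `t ↦ R - t` turns the endpoint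
  -- `t - R` into `-t`.
  congr 1
  have := intervalIntegral.integral_comp_sub_left (a := 0) (b := R)
    (fun t => ∫ s in (-t)..0, h s) R
  simpa using this

/-- A limit is nonnegative as soon as all the averages are. -/
theorem nonneg_of_tendsto_of_integral_nonneg {G : ℝ → ℝ} (hG : Continuous G) {L : ℝ}
    (hL : Tendsto G atTop (𝓝 L)) (hpos : ∀ R, 0 ≤ R → 0 ≤ ∫ r in (0 : ℝ)..R, G r) : 0 ≤ L := by
  by_contra hneg
  push Not at hneg
  have hev : ∀ᶠ r in atTop, G r < L / 2 := hL.eventually_lt_const (by linarith)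
  obtain ⟨R₀, hR₀⟩ := (hev.and (eventually_ge_atTop 0)).exists_forall_of_atTop
  set I := ∫ r in (0 : ℝ)..R₀, G r with hI
  have hI0 : 0 ≤ I := hpos R₀ (hR₀ R₀ le_rfl).2
  -- Beyond `R₀` the integrand is below `L / 2 < 0`; this length makes the tail at most `-(I + 1)`,
  -- which outweighs `I`.
  set R := R₀ + (I + 1) / (-L / 2) with hR
  have hle : R₀ ≤ R := by
    have : 0 ≤ (I + 1) / (-L / 2) := div_nonneg (by linarith) (by linarith)
    linarith
  have h1 : ∫ r in R₀..R, G r ≤ ∫ r in R₀..R, L / 2 :=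
    intervalIntegral.integral_mono_on hle (hG.intervalIntegrable _ _)
      intervalIntegrable_const fun r hr => (hR₀ r hr.1).1.le
  have h2 := hpos R ((hR₀ R₀ le_rfl).2.trans hle)
  rw [← intervalIntegral.integral_add_adjacent_intervals (hG.intervalIntegrable 0 R₀)
    (hG.intervalIntegrable R₀ R), ← hI] at h2
  rw [intervalIntegral.integral_const, smul_eq_mul] at h1
  have h3 : (R - R₀) * (L / 2) = -(I + 1) := by
    rw [hR]; field_simp [hneg.ne]; ring
  linarith

/-! ### Stationary correlation functions and positivity of their spectrum -/

/-- `f` is the correlation function of a stationary family of vectors. -/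
structure IsStationaryGram {E : Type*} [NormedAddCommGroup E] [InnerProductSpace ℂ E]
    (v : ℝ → E) (f : ℝ → ℂ) : Prop where
  inner_eq : ∀ t t', inner ℂ (v t) (v t') = f (t - t')

namespace IsStationaryGram

variable {E : Type*} [NormedAddCommGroup E] [InnerProductSpace ℂ E] {v : ℝ → E} {f : ℝ → ℂ}

theorem apply_neg (h : IsStationaryGram v f) (t : ℝ) : f (-t) = conj (f t) := by
  have h1 := h.inner_eq 0 t
  have h2 := h.inner_eq t 0
  rw [zero_sub] at h1
  rw [sub_zero] at h2
  rw [← h1, ← h2, inner_conj_symm]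

theorem norm_sq_eq (h : IsStationaryGram v f) (t : ℝ) : ‖v t‖ ^ 2 = (f 0).re := by
  rw [← inner_self_eq_norm_sq (𝕜 := ℂ), h.inner_eq, sub_self]
  rfl

theorem norm_le (h : IsStationaryGram v f) (t : ℝ) : ‖f t‖ ≤ (f 0).re := by
  have h1 := h.inner_eq t 0
  rw [sub_zero] at h1
  rw [← h1]
  refine (norm_inner_le_norm _ _).trans ?_
  nlinarith [h.norm_sq_eq t, h.norm_sq_eq 0, sq_nonneg (‖v t‖ - ‖v 0‖)]

/-- The integrand is bounded by `f 0`. Since `f` is only a.e. strongly measurable, measurability of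
`f (t - t')` relies on subtraction being quasi-measure-preserving. -/
theorem integrable_weighted (h : IsStationaryGram v f) (hf : AEStronglyMeasurable f volume)
    {g : ℝ → ℂ} (hg : Measurable g) (hg1 : ∀ t, ‖g t‖ = 1) (a b c d : ℝ) :
    Integrable (fun p : ℝ × ℝ => (conj (g p.1) * g p.2 * f (p.1 - p.2)).re)
      ((volume.restrict (Set.Ioc a b)).prod (volume.restrict (Set.Ioc c d))) := by
  have hmeas : AEStronglyMeasurable
      (fun p : ℝ × ℝ => (conj (g p.1) * g p.2 * f (p.1 - p.2)).re)
      ((volume.restrict (Set.Ioc a b)).prod (volume.restrict (Set.Ioc c d))) := by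
    rw [Measure.prod_restrict]
    have hsub := hf.comp_quasiMeasurePreserving (quasiMeasurePreserving_sub volume volume)
    refine (Complex.continuous_re.comp_aestronglyMeasurable
      (AEStronglyMeasurable.mul ?_ hsub)).restrict
    have : Measurable fun p : ℝ × ℝ => conj (g p.1) * g p.2 :=
      (Complex.continuous_conj.measurable.comp (hg.comp measurable_fst)).mul
        (hg.comp measurable_snd)
    exact this.aestronglyMeasurable
  refine Integrable.of_bound hmeas (f 0).re (ae_of_all _ fun p => ?_)
  refine (Complex.abs_re_le_norm _).trans ?_
  rw [norm_mul, norm_mul, RCLike.norm_conj, hg1, hg1, one_mul, one_mul]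
  exact h.norm_le _

/-- Integrated positivity of a stationary correlation function. -/
theorem integral_weighted_nonneg (h : IsStationaryGram v f) (hf : AEStronglyMeasurable f volume)
    {g : ℝ → ℂ} (hg : Measurable g) (hg1 : ∀ t, ‖g t‖ = 1) {T : ℝ} (hT : 0 ≤ T) :
    0 ≤ ∫ t in (0 : ℝ)..T, ∫ t' in (0 : ℝ)..T, (conj (g t) * g t' * f (t - t')).re := by
  have hinner : ∀ t t', (inner ℂ (g t • v t) (g t' • v t')).re =
      (conj (g t) * g t' * f (t - t')).re := fun t t' => by
    rw [inner_smul_left, inner_smul_right, h.inner_eq, mul_assoc]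
  have hint := h.integrable_weighted hf hg hg1 0 T 0 T
  -- The weighted kernel is the Gram kernel of `g t • v t`, whose diagonal is the constant `f 0`.
  have key := integral_re_inner_nonneg (volume.restrict (Set.Ioc 0 T)) (fun t => g t • v t)
    (M := (f 0).re)
    (fun t => by rw [norm_smul, hg1, one_mul, h.norm_sq_eq])
    (by simpa only [hinner] using hint)
    (by
      have : ∀ t, (inner ℂ (g t • v t) (g t • v t)).re = (f 0).re := fun t => by
        rw [← h.norm_sq_eq t, ← one_mul (‖v t‖), ← hg1 t, ← norm_smul,
          ← inner_self_eq_norm_sq (𝕜 := ℂ)]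
        rfl
      simp only [this]
      exact aestronglyMeasurable_const)
  simp only [hinner] at key
  rw [integral_prod _ hint] at key
  simpa only [intervalIntegral.integral_of_le hT] using key

theorem locallyIntegrable_exp_mul (hf : LocallyIntegrable f volume) (ω : ℝ) :
    LocallyIntegrable (fun t : ℝ => Complex.exp (-(Complex.I * ω * t)) * f t) volume := by
  rw [← locallyIntegrableOn_univ] at hf ⊢
  exact hf.continuousOn_mul (by fun_prop) isOpen_univ.isLocallyClosed

/-- The Fourier transform of a stationary correlation function, as far as it exists, is
nonnegative. -/
theorem fourier_nonneg (h : IsStationaryGram v f) (hf : LocallyIntegrable f volume) {ω : ℝ} {L : ℂ}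
    (hL : Tendsto (fun R : ℝ => ∫ t in (-R)..R, Complex.exp (-(Complex.I * ω * t)) * f t)
      atTop (𝓝 L)) : 0 ≤ L := by
  set k : ℝ → ℂ := fun t => Complex.exp (-(Complex.I * ω * t)) * f t with hk
  have hkloc : LocallyIntegrable k volume := locallyIntegrable_exp_mul hf ω
  have hkint : ∀ a b, IntervalIntegrable k volume a b := 
    intervalIntegrable_of_locallyIntegrable hkloc
  -- The phase preserves Hermitian symmetry, so integrals over symmetric intervals are real.
  have hconj : ∀ t, k (-t) = conj (k t) := fun t => by
    simp only [hk, h.apply_neg, map_mul, ← Complex.exp_conj]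
    congr 2
    simp
  have him : ∀ R : ℝ, (∫ t in (-R)..R, k t).im = 0 := fun R => by
    rw [← Complex.conj_eq_iff_im, ← intervalIntegral.intervalIntegral_conj]
    simp_rw [← hconj]
    rw [intervalIntegral.integral_comp_neg, neg_neg]
  have hkre : LocallyIntegrable (fun t => (k t).re) volume := fun x => by
    obtain ⟨s, hs, hi⟩ := hkloc x
    exact ⟨s, hs, hi.re⟩
  have hre : ∀ a b : ℝ, (∫ t in a..b, k t).re = ∫ t in a..b, (k t).re := fun a b => by
    exact (intervalIntegral.intervalIntegral_re (hkint a b)).symm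
  refine Complex.nonneg_iff.2 ⟨?_, ?_⟩
  · have hLre := (Complex.continuous_re.tendsto L).comp hL
    refine nonneg_of_tendsto_of_integral_nonneg (G := fun R => (∫ t in (-R)..R, k t).re) ?_ hLre ?_
    · refine Complex.continuous_re.comp ?_
      have hc := intervalIntegral.continuous_primitive hkint 0
      have : (fun R : ℝ => ∫ t in (-R)..R, k t) = fun R =>
          (∫ t in (0 : ℝ)..R, k t) - ∫ t in (0 : ℝ)..(-R), k t := funext fun R =>
        (intervalIntegral.integral_interval_sub_left (hkint _ _) (hkint _ _)).symm
      rw [this]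
      exact hc.sub (hc.comp continuous_neg)
    · intro R hR
      simp_rw [hre]
      -- Integrating the truncations over `r` gives a square integral of the kernel weighted by `exp
      -- (i ω t)`.
      rw [← integral_integral_sub_eq hkre]
      have := h.integral_weighted_nonneg hf.aestronglyMeasurable
        (g := fun t => Complex.exp (Complex.I * ω * t)) (by fun_prop)
        (fun t => by
          rw [show Complex.I * ω * t = ((ω * t : ℝ) : ℂ) * Complex.I by push_cast; ring]
          exact Complex.norm_exp_ofReal_mul_I _) hR
      convert this using 8 with t t'
      rw [← Complex.exp_conj, ← Complex.exp_add]
      congr 1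
      simp
      ring
  · have hLim := (Complex.continuous_im.tendsto L).comp hL
    refine tendsto_nhds_unique tendsto_const_nhds (hLim.congr fun R => ?_)
    exact him R

end IsStationaryGram

/-! ### The cross inequality for two adjacent time intervals -/

namespace IsStationaryGram

variable {E : Type*} [NormedAddCommGroup E] [InnerProductSpace ℂ E] {v : ℝ → E} {f : ℝ → ℂ}

theorem add_apply_neg (h : IsStationaryGram v f) (s : ℝ) :
    f s + f (-s) = ((2 * (f s).re : ℝ) : ℂ) := by
  rw [h.apply_neg, Complex.add_conj]

theorem sub_apply_neg (h : IsStationaryGram v f) (s : ℝ) :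
    f s - f (-s) = ((2 * (f s).im : ℝ) : ℂ) * Complex.I := by
  rw [h.apply_neg, Complex.sub_conj]

/-- Integrated positivity with weight `1` on `(0, T₁]` and weight `σ i` on `(T₁, T₁ + T₂]`. -/
theorem cross_nonneg (h : IsStationaryGram v f) (hf : LocallyIntegrable f volume)
    {T₁ T₂ : ℝ} (h₁ : 0 ≤ T₁) (h₂ : 0 ≤ T₂) {σ : ℝ} (hσ : |σ| = 1) :
    0 ≤ (∫ t in (0 : ℝ)..T₁, ∫ t' in (0 : ℝ)..T₁, (f (t - t')).re) +
      (∫ t in (0 : ℝ)..T₂, ∫ t' in (0 : ℝ)..T₂, (f (t - t')).re) +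
      2 * (σ * ∫ t in T₁..(T₁ + T₂), ∫ t' in (0 : ℝ)..T₁, (f (t - t')).im) := by
  have hT : T₁ ≤ T₁ + T₂ := by linarith
  have hre : LocallyIntegrable (fun t => (f t).re) volume := fun x => by
    obtain ⟨s, hs, hi⟩ := hf x
    exact ⟨s, hs, hi.re⟩
  have him : LocallyIntegrable (fun t => (f t).im) volume := fun x => by
    obtain ⟨s, hs, hi⟩ := hf x
    exact ⟨s, hs, hi.im⟩
  have hrei : ∀ t a b, IntervalIntegrable (fun t' => (f (t - t')).re) volume a b := fun t a b => by
    simpa using (intervalIntegrable_of_locallyIntegrable hre (t - a) (t - b)).comp_sub_left t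
  have himi : ∀ t a b, IntervalIntegrable (fun t' => (f (t - t')).im) volume a b := fun t a b => by
    simpa using (intervalIntegrable_of_locallyIntegrable him (t - a) (t - b)).comp_sub_left t
  have hrec := continuous_intervalIntegral_sub hre
  have himc := continuous_intervalIntegral_sub him
  -- On the mixed blocks `conj (g t) * g t'` is `±σ i`, which selects `Im f`, the commutator part;
  -- on the two squares it is `1`.
  set g : ℝ → ℂ := fun t => if t ≤ T₁ then 1 else σ * Complex.I with hg
  have hgm : Measurable g := Measurable.ite measurableSet_Iic measurable_const measurable_const
  have hg1 : ∀ t, ‖g t‖ = 1 := fun t => by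
    simp only [hg]
    split_ifs <;> simp [hσ]
  have hσ2 : σ * σ = 1 := by rw [← abs_mul_abs_self, hσ, one_mul]
  have key := h.integral_weighted_nonneg hf.aestronglyMeasurable hgm hg1 (T := T₁ + T₂)
    (by linarith)
  set k : ℝ → ℝ → ℝ := fun t t' => (conj (g t) * g t' * f (t - t')).re with hk
  have kAA : ∀ t ≤ T₁, ∀ t' ≤ T₁, k t t' = (f (t - t')).re := fun t ht t' ht' => by
    simp [hk, hg, ht, ht']
  have kAB : ∀ t ≤ T₁, ∀ t', T₁ < t' → k t t' = -(σ * (f (t - t')).im) := fun t ht t' ht' => by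
    simp [hk, hg, ht, ht'.not_ge]
  have kBA : ∀ t, T₁ < t → ∀ t' ≤ T₁, k t t' = σ * (f (t - t')).im := fun t ht t' ht' => by
    simp [hk, hg, ht.not_ge, ht']
  have kBB : ∀ t, T₁ < t → ∀ t', T₁ < t' → k t t' = (f (t - t')).re := fun t ht t' ht' => by
    simp [hk, hg, ht.not_ge, ht'.not_ge, hσ2]
  have hcongr : ∀ {φ ψ : ℝ → ℝ} {a b : ℝ}, a ≤ b → (∀ x ∈ Set.Ioc a b, φ x = ψ x) →
      IntervalIntegrable ψ volume a b → IntervalIntegrable φ volume a b := by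
    intro φ ψ a b hab he hi
    refine hi.congr fun x hx => (he x ?_).symm
    rwa [Set.uIoc_of_le hab] at hx
  have innerA : ∀ t ≤ T₁, ∫ t' in (0 : ℝ)..(T₁ + T₂), k t t' =
      (∫ t' in (0 : ℝ)..T₁, (f (t - t')).re) - σ * ∫ t' in T₁..(T₁ + T₂), (f (t - t')).im := by
    intro t ht
    rw [← intervalIntegral.integral_add_adjacent_intervals
      (hcongr h₁ (fun x hx => kAA t ht x hx.2) (hrei t 0 T₁))
      (hcongr hT (fun x hx => kAB t ht x hx.1) ((himi t _ _).const_mul σ).neg),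
      intervalIntegral_congr_of_mem_Ioc h₁ fun x hx => kAA t ht x hx.2,
      intervalIntegral_congr_of_mem_Ioc hT fun x hx => kAB t ht x hx.1,
      intervalIntegral.integral_neg, intervalIntegral.integral_const_mul, sub_eq_add_neg]
  have innerB : ∀ t, T₁ < t → ∫ t' in (0 : ℝ)..(T₁ + T₂), k t t' =
      (σ * ∫ t' in (0 : ℝ)..T₁, (f (t - t')).im) + ∫ t' in T₁..(T₁ + T₂), (f (t - t')).re := by
    intro t ht
    rw [← intervalIntegral.integral_add_adjacent_intervals
      (hcongr h₁ (fun x hx => kBA t ht x hx.2) ((himi t 0 T₁).const_mul σ))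
      (hcongr hT (fun x hx => kBB t ht x hx.1) (hrei t _ _)),
      intervalIntegral_congr_of_mem_Ioc h₁ fun x hx => kBA t ht x hx.2,
      intervalIntegral_congr_of_mem_Ioc hT fun x hx => kBB t ht x hx.1,
      intervalIntegral.integral_const_mul]
  have cA : Continuous fun t => (∫ t' in (0 : ℝ)..T₁, (f (t - t')).re) -
      σ * ∫ t' in T₁..(T₁ + T₂), (f (t - t')).im :=
    (hrec _ _).sub (continuous_const.mul (himc _ _))
  have cB : Continuous fun t => (σ * ∫ t' in (0 : ℝ)..T₁, (f (t - t')).im) +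
      ∫ t' in T₁..(T₁ + T₂), (f (t - t')).re :=
    (continuous_const.mul (himc _ _)).add (hrec _ _)
  have hσi : ∀ c d a b, IntervalIntegrable (fun t => σ * ∫ t' in c..d, (f (t - t')).im)
      volume a b := fun c d a b => (continuous_const.mul (himc c d)).intervalIntegrable a b
  rw [← intervalIntegral.integral_add_adjacent_intervals
      (hcongr h₁ (fun x hx => innerA x hx.2) (cA.intervalIntegrable _ _))
      (hcongr hT (fun x hx => innerB x hx.1) (cB.intervalIntegrable _ _)),
      intervalIntegral_congr_of_mem_Ioc h₁ fun x hx => innerA x hx.2,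
      intervalIntegral_congr_of_mem_Ioc hT fun x hx => innerB x hx.1,
      intervalIntegral.integral_sub ((hrec _ _).intervalIntegrable _ _)
        (hσi _ _ _ _),
      intervalIntegral.integral_add (hσi _ _ _ _)
        ((hrec _ _).intervalIntegrable _ _),
      intervalIntegral.integral_const_mul, intervalIntegral.integral_const_mul] at key
  -- The kernel depends on `t - t'` only, so the second square can be translated to the origin.
  have hBB : ∫ t in T₁..(T₁ + T₂), ∫ t' in T₁..(T₁ + T₂), (f (t - t')).re =
      ∫ t in (0 : ℝ)..T₂, ∫ t' in (0 : ℝ)..T₂, (f (t - t')).re := by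
    have h1 : ∀ t, ∫ t' in T₁..(T₁ + T₂), (f (t - t')).re =
        ∫ t' in (0 : ℝ)..T₂, (f (t - T₁ - t')).re := fun t => by
      have := intervalIntegral.integral_comp_add_left (a := 0) (b := T₂)
        (fun t' => (f (t - t')).re) T₁
      rw [add_zero] at this
      rw [← this]
      simp_rw [sub_sub]
    simp_rw [h1]
    have := intervalIntegral.integral_comp_sub_right (a := T₁) (b := T₁ + T₂)
      (fun t => ∫ t' in (0 : ℝ)..T₂, (f (t - t')).re) T₁
    simpa using this
  -- Because `Im f` is odd, the two mixed blocks add up instead of cancelling, whence the factor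
  -- `2`.
  have hAB : ∫ t in (0 : ℝ)..T₁, ∫ t' in T₁..(T₁ + T₂), (f (t - t')).im =
      -∫ t in T₁..(T₁ + T₂), ∫ t' in (0 : ℝ)..T₁, (f (t - t')).im := by
    have hodd : ∀ t t', (f (t - t')).im = -(f (t' - t)).im := fun t t' => by
      rw [← neg_sub t' t, h.apply_neg, Complex.conj_im]
    -- Serves Fubini: on this rectangle the weight is `-i`, so the integrand is `Im f`.
    have hw := (h.integrable_weighted hf.aestronglyMeasurable 
      (g := fun t => if t ≤ T₁ then 1 else -Complex.I)
      (Measurable.ite measurableSet_Iic measurable_const measurable_const)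
      (fun t => by split_ifs <;> simp) 0 T₁ T₁ (T₁ + T₂))
    rw [intervalIntegral_intervalIntegral_swap]
    · rw [← intervalIntegral.integral_neg]
      refine intervalIntegral.integral_congr fun t _ => ?_
      rw [← intervalIntegral.integral_neg]
      exact intervalIntegral.integral_congr fun t' _ => hodd _ _
    · rw [Set.uIoc_of_le h₁, Set.uIoc_of_le hT]
      rw [Measure.prod_restrict] at hw
      refine Integrable.congr hw ?_
      refine (ae_restrict_iff' (measurableSet_Ioc.prod measurableSet_Ioc)).2 (ae_of_all _ ?_)
      rintro ⟨t, t'⟩ ⟨ht, ht'⟩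
      simp [ht.2, ht'.1.not_ge]
  rw [hBB, hAB] at key
  linarith

end IsStationaryGram

/-! ### The inequalities for stationary baths -/

namespace Bath

variable {H : Type*} [NormedAddCommGroup H] [InnerProductSpace ℂ H] [CompleteSpace H]
  {Ω : Type*} [MeasurableSpace Ω] {P : Measure Ω}

theorem IsWideSenseStationary.isStationaryGram {b : Bath H P} (hb : b.IsWideSenseStationary) :
    IsStationaryGram b.vec fun t => b.corr t 0 :=
  ⟨fun t t' => by rw [← corr_eq_inner_vec, hb.corr_eq]⟩

theorem IsWideSenseStationary.anticommCorr_eq {b : Bath H P} (hb : b.IsWideSenseStationary)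
    (t t' : ℝ) : b.anticommCorr t t' = ((2 * (b.corr (t - t') 0).re : ℝ) : ℂ) := by
  rw [anticommCorr, hb.corr_eq t t', hb.corr_eq t' t, ← neg_sub t t']
  exact hb.isStationaryGram.add_apply_neg _

theorem IsWideSenseStationary.commCorr_eq {b : Bath H P} (hb : b.IsWideSenseStationary)
    (t t' : ℝ) : b.commCorr t t' = ((2 * (b.corr (t - t') 0).im : ℝ) : ℂ) * Complex.I := by
  rw [commCorr, hb.corr_eq t t', hb.corr_eq t' t, ← neg_sub t t']
  exact hb.isStationaryGram.sub_apply_neg _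

theorem locallyIntegrable_corr {b : Bath H P}
    (hp : LocallyIntegrable (fun t => b.anticommCorr t 0) volume)
    (hm : LocallyIntegrable (fun t => b.commCorr t 0) volume) :
    LocallyIntegrable (fun t => b.corr t 0) volume := by
  have := (hp.add hm).smul (2⁻¹ : ℂ)
  convert this using 1
  funext t
  simp [anticommCorr, commCorr]
  ring

theorem IsWideSenseStationary.abs_spectrum_le {b : Bath H P} (hb : b.IsWideSenseStationary)
    {Sp Sm : ℝ → ℂ} (hp : HasFourier (fun t => b.anticommCorr t 0) Sp)
    (hm : HasFourier (fun t => b.commCorr t 0) Sm) (ω : ℝ) :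
    (Sm ω).im = 0 ∧ ((‖Sm ω‖ : ℝ) : ℂ) ≤ Sp ω := by
  have hf := locallyIntegrable_corr hp.locallyIntegrable hm.locallyIntegrable
  have hG := hb.isStationaryGram
  have hneg : ∀ t, b.corr 0 t = b.corr (-t) 0 := fun t => by rw [hb.corr_eq 0 t, zero_sub]
  have hexp : ∀ {φ : ℝ → ℂ}, LocallyIntegrable φ volume → ∀ R : ℝ, IntervalIntegrable
      (fun t : ℝ => Complex.exp (-(Complex.I * ω * t)) * φ t) volume (-R) R := fun hφ R =>
    intervalIntegrable_of_locallyIntegrable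
      (IsStationaryGram.locallyIntegrable_exp_mul hφ ω) _ _
  have h1 : (0 : ℂ) ≤ (Sp ω + Sm ω) / 2 := by
    refine hG.fourier_nonneg hf (ω := ω)
      ((((hp.tendsto ω).add (hm.tendsto ω)).div_const 2).congr fun R => ?_)
    rw [← intervalIntegral.integral_add (hexp hp.locallyIntegrable R)
      (hexp hm.locallyIntegrable R), ← intervalIntegral.integral_div]
    refine intervalIntegral.integral_congr fun t _ => ?_
    simp only [anticommCorr, commCorr]
    ring
  -- Half the difference of the two correlations is `corr 0 t = corr (-t) 0`, so its transform at
  -- `ω` is that of `corr t 0` at `-ω`.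
  have h2 : (0 : ℂ) ≤ (Sp ω - Sm ω) / 2 := by
    refine hG.fourier_nonneg hf (ω := -ω)
      ((((hp.tendsto ω).sub (hm.tendsto ω)).div_const 2).congr fun R => ?_)
    rw [← intervalIntegral.integral_sub (hexp hp.locallyIntegrable R)
      (hexp hm.locallyIntegrable R), ← intervalIntegral.integral_div]
    have := intervalIntegral.integral_comp_neg (a := -R) (b := R)
      (fun t : ℝ => Complex.exp (-(Complex.I * ((-ω : ℝ) : ℂ) * t)) * b.corr t 0)
    rw [neg_neg] at this
    rw [← this]
    refine intervalIntegral.integral_congr fun t _ => ?_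
    simp only [anticommCorr, commCorr, hneg, Complex.ofReal_neg]
    ring_nf
  rw [Complex.nonneg_iff] at h1 h2
  simp only [Complex.div_ofNat_re, Complex.div_ofNat_im, Complex.add_re, Complex.add_im,
    Complex.sub_re, Complex.sub_im] at h1 h2
  have him : (Sm ω).im = 0 := by linarith [h1.2, h2.2]
  have hip : (Sp ω).im = 0 := by linarith [h1.2, h2.2]
  refine ⟨him, Complex.le_def.2 ⟨?_, by simp [hip]⟩⟩
  rw [Complex.ofReal_re, ← Complex.re_add_im (Sm ω), him]
  simp only [Complex.ofReal_zero, zero_mul, add_zero, Complex.norm_real, Real.norm_eq_abs]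
  exact abs_le.2 ⟨by linarith [h1.1], by linarith [h2.1]⟩

theorem IsWideSenseStationary.norm_commCorr_le {b : Bath H P} (hb : b.IsWideSenseStationary)
    (t t' : ℝ) : ((‖b.commCorr t t'‖ : ℝ) : ℂ) ≤ b.anticommCorr 0 0 := by
  rw [hb.anticommCorr_eq, hb.commCorr_eq, Complex.real_le_real, norm_mul, Complex.norm_I, mul_one,
    Complex.norm_real, Real.norm_eq_abs, abs_mul, sub_zero, abs_of_pos (two_pos : (0 : ℝ) < 2)]
  have := (Complex.abs_im_le_norm _).trans (hb.isStationaryGram.norm_le (t - t'))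
  linarith

theorem IsWideSenseStationary.norm_integral_commCorr_le {b : Bath H P}
    (hb : b.IsWideSenseStationary) (hf : LocallyIntegrable (fun t => b.corr t 0) volume)
    {T₁ T₂ : ℝ} (h₁ : 0 ≤ T₁) (h₂ : 0 ≤ T₂) :
    ((2 * ‖∫ t in T₁..(T₁ + T₂), ∫ t' in (0 : ℝ)..T₁, b.commCorr t t'‖ : ℝ) : ℂ) ≤
      (∫ t in (0 : ℝ)..T₁, ∫ t' in (0 : ℝ)..T₁, b.anticommCorr t t') +
      (∫ t in (0 : ℝ)..T₂, ∫ t' in (0 : ℝ)..T₂, b.anticommCorr t t') := by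
  simp_rw [hb.anticommCorr_eq, hb.commCorr_eq, intervalIntegral.integral_mul_const,
    intervalIntegral.integral_ofReal, intervalIntegral.integral_const_mul, norm_mul]
  rw [← Complex.ofReal_add, Complex.real_le_real, Complex.norm_I, mul_one, Complex.norm_real,
    Real.norm_eq_abs, abs_mul, abs_of_pos (two_pos : (0 : ℝ) < 2)]
  have hp := hb.isStationaryGram.cross_nonneg hf h₁ h₂ (σ := 1) (by simp)
  have hm := hb.isStationaryGram.cross_nonneg hf h₁ h₂ (σ := -1) (by simp)
  rw [one_mul] at hp
  rw [neg_one_mul] at hm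
  rcases abs_cases (∫ t in T₁..(T₁ + T₂), ∫ t' in (0 : ℝ)..T₁, (b.corr (t - t') 0).im) with
    hc | hc <;> rw [hc.1] <;> linarith

end Bath

/-! ### Integrability of the spectra and Fourier inversion -/

/-- A nonnegative function with a symmetric improper integral is integrable. -/
theorem HasFourierInv.integrable {S : ℝ → ℝ} {c : ℝ → ℂ}
    (h : HasFourierInv (fun ω => (S ω : ℂ)) c) (hS : ∀ ω, 0 ≤ S ω) : Integrable S volume := by
  have hloc : ∀ R : ℝ, IntegrableOn (fun ω => (S ω : ℂ)) (Set.Ioc (-R) R) volume := fun R =>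
    (h.locallyIntegrable.integrableOn_isCompact isCompact_Icc).mono_set Set.Ioc_subset_Icc_self
  -- At time `0` the phase is `1`, so the truncated integrals of `S = |S|` converge.
  have h0 := (h.tendsto 0).const_mul (2 * Real.pi : ℂ)
  have hre := (Complex.continuous_re.tendsto _).comp h0
  have hi : Integrable (fun ω => (S ω : ℂ)) volume := by
    refine integrable_of_intervalIntegral_norm_tendsto _ hloc tendsto_neg_atTop_atBot tendsto_id
      (hre.congr fun R => ?_)
    have hpi : (2 * Real.pi : ℂ) ≠ 0 := by simp [Real.pi_ne_zero]
    simp only [Function.comp_apply, Complex.ofReal_zero, mul_zero, Complex.exp_zero, one_mul]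
    rw [← mul_assoc, mul_one_div_cancel hpi, one_mul, intervalIntegral.integral_ofReal,
      Complex.ofReal_re]
    refine intervalIntegral.integral_congr fun ω _ => ?_
    simp [abs_of_nonneg (hS ω)]
  simpa using hi.re

theorem integrable_exp_mul {S : ℝ → ℂ} (hS : Integrable S volume) (t : ℝ) :
    Integrable (fun ω : ℝ => Complex.exp (Complex.I * ω * t) * S ω) volume := by
  refine hS.bdd_mul (c := 1) (by fun_prop) (ae_of_all _ fun ω => ?_)
  rw [show Complex.I * ω * t = ((ω * t : ℝ) : ℂ) * Complex.I by push_cast; ring,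
    Complex.norm_exp_ofReal_mul_I]

theorem HasFourierInv.eq_integral {S c : ℝ → ℂ} (h : HasFourierInv S c)
    (hS : Integrable S volume) (t : ℝ) :
    c t = (1 / (2 * Real.pi) : ℂ) * ∫ ω : ℝ, Complex.exp (Complex.I * ω * t) * S ω :=
  tendsto_nhds_unique (h.tendsto t) ((intervalIntegral_tendsto_integral (integrable_exp_mul hS t)
    tendsto_neg_atTop_atBot tendsto_id).const_mul _)

/-- Passes from angular frequency to the kernel `exp (-2 π i x ω)` of `𝓕`. -/
theorem integral_exp_neg_mul_eq_fourier (φ : ℝ → ℂ) (t : ℝ) :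
    ∫ ω : ℝ, Complex.exp (-(Complex.I * ω * t)) * φ ω = 𝓕 φ (t / (2 * Real.pi)) := by
  rw [Real.fourier_real_eq_integral_exp_smul]
  refine integral_congr_ae (ae_of_all _ fun ω => ?_)
  simp only [smul_eq_mul]
  congr 2
  push_cast
  have : (Real.pi : ℂ) ≠ 0 := by simp [Real.pi_ne_zero]
  field_simp

theorem integral_exp_mul_eq_fourierInv (φ : ℝ → ℂ) (t : ℝ) :
    ∫ ω : ℝ, Complex.exp (Complex.I * ω * t) * φ ω = 𝓕⁻ φ (t / (2 * Real.pi)) := by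
  rw [Real.fourierInv_eq_fourier_neg, ← neg_div, ← integral_exp_neg_mul_eq_fourier]
  refine integral_congr_ae (ae_of_all _ fun ω => ?_)
  simp

/-- `𝓕⁻ S` is `𝓕` of the reflected `S`. Moving this `𝓕` onto `𝓕 φ` yields the reflected `φ`, and the
two reflections cancel. -/
theorem integral_fourierInv_mul_fourier {S : ℝ → ℂ} (hS : Integrable S volume)
    (φ : SchwartzMap ℝ ℂ) : ∫ x, 𝓕⁻ S x * 𝓕 (φ : ℝ → ℂ) x = ∫ ω, S ω * φ ω := by
  have hφ : Integrable (𝓕 (φ : ℝ → ℂ)) volume := by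
    rw [← SchwartzMap.fourier_coe]; exact (𝓕 φ).integrable
  have hinv : 𝓕⁻ (𝓕 (φ : ℝ → ℂ)) = φ := φ.continuous.fourierInv_fourier_eq φ.integrable hφ
  have key := VectorFourier.integral_fourierIntegral_smul_eq_flip (L := innerₗ ℝ) (μ := volume)
    (ν := volume) Real.continuous_fourierChar continuous_inner hS.comp_neg hφ
  rw [Real.fourierInv_eq_fourier_comp_neg]
  refine key.trans ?_
  rw [flip_innerₗ]
  have h2 : ∀ x, VectorFourier.fourierIntegral Real.fourierChar volume (innerₗ ℝ)
      (𝓕 (φ : ℝ → ℂ)) x = φ (-x) := fun x => by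
    rw [← hinv, Real.fourierInv_eq_fourier_neg, neg_neg, hinv]
    rfl
  simp_rw [h2, smul_eq_mul]
  exact integral_neg_eq_self (fun x => S x * φ x) volume

/-- The inverse Fourier transform of an integrable `S` has the Fourier transform `S` in the sense of
tempered distributions. -/
theorem hasTemperedFourier_of_integrable {S c : ℝ → ℂ} (hS : Integrable S volume)
    (hc : ∀ t : ℝ, c t =
      (1 / (2 * Real.pi) : ℂ) * ∫ ω : ℝ, Complex.exp (Complex.I * ω * t) * S ω) :
    HasTemperedFourier c S := by
  intro φ
  simp_rw [hc, integral_exp_neg_mul_eq_fourier, integral_exp_mul_eq_fourierInv, mul_assoc]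
  rw [integral_const_mul, Measure.integral_comp_div
    (fun x => 𝓕⁻ S x * 𝓕 (φ : ℝ → ℂ) x), integral_fourierInv_mul_fourier hS,
    abs_of_pos Real.two_pi_pos, Complex.real_smul]
  have : (Real.pi : ℂ) ≠ 0 := by simp [Real.pi_ne_zero]
  push_cast
  field_simp

/-- Pointwise Fourier inversion, when the inverse Fourier transform of a continuous integrable `S`
is integrable. -/
theorem hasFourier_of_integrable {S c : ℝ → ℂ} (hS : Integrable S volume) (hcont : Continuous S)
    (hc : ∀ t : ℝ, c t =
      (1 / (2 * Real.pi) : ℂ) * ∫ ω : ℝ, Complex.exp (Complex.I * ω * t) * S ω)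
    (hint : Integrable c volume) : HasFourier c S := by
  have hpi : (Real.pi : ℂ) ≠ 0 := by simp [Real.pi_ne_zero]
  have hc' : ∀ t : ℝ, c t = (1 / (2 * Real.pi) : ℂ) * 𝓕⁻ S (t / (2 * Real.pi)) := fun t => by
    rw [hc, integral_exp_mul_eq_fourierInv]
  -- Inversion requires `𝓕 S` to be integrable; it is the reflection of `𝓕⁻ S`, which is a rescaled
  -- `c`.
  have hSinv : Integrable (𝓕⁻ S) volume := by
    have := (hint.comp_mul_left' Real.two_pi_pos.ne').const_mul (2 * Real.pi : ℂ)
    refine this.congr (ae_of_all _ fun x => ?_)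
    simp only [hc']
    rw [mul_div_cancel_left₀ _ Real.two_pi_pos.ne']
    field_simp
  have hSfou : Integrable (𝓕 S) volume := by
    refine hSinv.comp_neg.congr (ae_of_all _ fun x => ?_)
    simp only [Real.fourierInv_eq_fourier_neg, neg_neg]
  refine ⟨hint.locallyIntegrable, fun ω => ?_⟩
  have hexp : Integrable (fun t : ℝ => Complex.exp (-(Complex.I * ω * t)) * c t) volume := by
    refine (integrable_exp_mul hint (-ω)).congr (ae_of_all _ fun t => ?_)
    simp only [Complex.ofReal_neg]
    ring_nf
  have hval : ∫ t : ℝ, Complex.exp (-(Complex.I * ω * t)) * c t = S ω := by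
    have h1 : 𝓕 (𝓕⁻ S) ω = S ω := congrFun (hcont.fourier_fourierInv_eq hS hSfou) ω
    rw [← h1, Real.fourier_real_eq_integral_exp_smul]
    have h2 : ∀ t : ℝ, Complex.exp (-(Complex.I * ω * t)) * c t = (1 / (2 * Real.pi) : ℂ) *
        (fun x : ℝ => Complex.exp (((-2 * Real.pi * x * ω : ℝ) : ℂ) * Complex.I) • 𝓕⁻ S x)
          (t / (2 * Real.pi)) := fun t => by
      rw [hc']
      simp only [smul_eq_mul]
      rw [mul_left_comm]
      congr 3
      push_cast
      field_simp
    simp_rw [h2]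
    rw [integral_const_mul, Measure.integral_comp_div (fun x : ℝ =>
      Complex.exp (((-2 * Real.pi * x * ω : ℝ) : ℂ) * Complex.I) • 𝓕⁻ S x),
      abs_of_pos Real.two_pi_pos, Complex.real_smul, ← mul_assoc]
    push_cast
    rw [one_div, inv_mul_cancel₀ (by simp [hpi]), one_mul]
  rw [← hval]
  exact intervalIntegral_tendsto_integral hexp tendsto_neg_atTop_atBot tendsto_id

/-! ### Everywhere defined operators and pure states -/

theorem pmapApply_toPMap_top {H : Type*} [NormedAddCommGroup H] [InnerProductSpace ℂ H]
    (A : H →ₗ[ℂ] H) (x : H) : pmapApply (A.toPMap ⊤) x = A x := by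
  unfold pmapApply
  rw [dif_pos (by simp)]
  simp

section RankOneState

variable {H : Type*} [NormedAddCommGroup H] [InnerProductSpace ℂ H] [CompleteSpace H] {u : H}

theorem sqrt_rankOne_self (hu : ‖u‖ = 1) : CFC.sqrt (rankOne ℂ u u) = rankOne ℂ u u :=
  CFC.sqrt_unique (isIdempotentElem_rankOne_self hu)
    ((ContinuousLinearMap.nonneg_iff_isPositive _).2 (isPositive_rankOne_self u))

theorem sqrtVec_rankOne_self (hu : ‖u‖ = 1) (i : BasisIndex H) :
    sqrtVec (rankOne ℂ u u) i = inner ℂ u (onb H i) • u := by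
  rw [sqrtVec, sqrt_rankOne_self hu, rankOne_apply]

theorem isDensityOperator_rankOne_self (hu : ‖u‖ = 1) : IsDensityOperator (rankOne ℂ u u) := by
  refine ⟨isPositive_rankOne_self u, ?_⟩
  have h := (onb H).hasSum_inner_mul_inner u u
  rw [inner_self_eq_norm_sq_to_K, hu] at h
  simpa [inner_smul_right] using h

/-- In a pure state `√ρ eᵢ = ⟪u, eᵢ⟫ u`, so by Parseval every trace collapses to a single inner
product. -/
theorem tsum_inner_smul_inner_smul (hu : ‖u‖ = 1) (x y : H) :
    ∑' i, inner ℂ (inner ℂ u (onb H i) • x) (inner ℂ u (onb H i) • y) = inner ℂ x y := by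
  have h := ((onb H).hasSum_inner_mul_inner u u).mul_right (inner ℂ x y)
  rw [inner_self_eq_norm_sq_to_K, hu] at h
  refine (HasSum.tsum_eq ?_).trans (by simp : ((1 : ℝ) : ℂ) ^ 2 * inner ℂ x y = _)
  refine h.congr_fun fun i => ?_
  rw [inner_smul_left, inner_smul_right, inner_conj_symm]
  ring

theorem tsum_enorm_inner_smul_sq (hu : ‖u‖ = 1) (x : H) :
    ∑' i, ‖inner ℂ u (onb H i) • x‖ₑ ^ 2 = ‖x‖ₑ ^ 2 := by
  have h := (onb H).hasSum_inner_mul_inner u u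
  rw [inner_self_eq_norm_sq_to_K, hu] at h
  have h2 : HasSum (fun i => ‖inner ℂ u (onb H i)‖ ^ 2) 1 := by
    have := Complex.hasSum_re h
    simp only [Complex.coe_algebraMap, Complex.ofReal_one, one_pow, Complex.one_re] at this
    refine this.congr_fun fun i => ?_
    have hi := inner_mul_symm_re_eq_norm (𝕜 := ℂ) u (onb H i)
    rw [norm_mul, norm_inner_symm (onb H i) u, ← sq] at hi
    exact hi.symm
  simp_rw [enorm_smul, mul_pow]
  rw [ENNReal.tsum_mul_right]
  have h3 : ∑' i, ‖inner ℂ u (onb H i)‖ₑ ^ 2 = 1 := by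
    simp_rw [← ofReal_norm, ← ENNReal.ofReal_pow (norm_nonneg _)]
    rw [← ENNReal.ofReal_tsum_of_nonneg (fun i => sq_nonneg _) h2.summable, h2.tsum_eq,
      ENNReal.ofReal_one]
  rw [h3, one_mul]

theorem isSelfAdjoint_toPMap_top {A : H →L[ℂ] H} (hA : IsSelfAdjoint A) :
    IsSelfAdjoint ((A : H →ₗ[ℂ] H).toPMap ⊤) := by
  rw [LinearPMap.isSelfAdjoint_def, ContinuousLinearMap.toPMap_adjoint_eq_adjoint_toPMap_of_dense]
  · rw [hA.adjoint_eq]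
  · simp

end RankOneState

/-! ### The two-level bath with random frequency -/

/-- Any finite spectral density is, up to a factor, that of a probability measure. -/
theorem exists_probabilityMeasure_density {h : ℝ → ℝ} (hh : Integrable h volume)
    (h0 : ∀ ω, 0 ≤ h ω) :
    ∃ (P : Measure ℝ) (_ : IsProbabilityMeasure P) (a : ℝ), ∀ φ : ℝ → ℂ,
      ∫ ω, (a : ℂ) ^ 2 * φ ω ∂P = ∫ ω, φ ω * h ω := by
  set m := ∫ ω, h ω with hm
  have hm0 : 0 ≤ m := integral_nonneg h0
  rcases hm0.eq_or_lt with hm0 | hm0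
  -- A null density cannot be normalised; with amplitude `0` any probability measure serves.
  · refine ⟨Measure.dirac 0, inferInstance, 0, fun φ => ?_⟩
    have hz : h =ᵐ[volume] 0 := (integral_eq_zero_iff_of_nonneg h0 hh).1 hm0.symm
    have hz' : (fun ω => φ ω * (h ω : ℂ)) =ᵐ[volume] 0 := by
      filter_upwards [hz] with ω hω
      simp [hω]
    rw [integral_congr_ae hz']
    simp
  -- The amplitude `√m` restores the mass `m`, as correlations are quadratic in it.
  · refine ⟨volume.withDensity fun ω => ENNReal.ofReal (h ω / m), ⟨?_⟩, Real.sqrt m, fun φ => ?_⟩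
    · rw [withDensity_apply _ MeasurableSet.univ, Measure.restrict_univ,
        ← ofReal_integral_eq_lintegral_ofReal (hh.div_const m)
          (ae_of_all _ fun ω => div_nonneg (h0 ω) hm0.le), integral_div, div_self hm0.ne',
        ENNReal.ofReal_one]
    · rw [integral_withDensity_eq_integral_toReal_smul₀ (hh.div_const m).1.aemeasurable.ennreal_ofReal
        (ae_of_all _ fun ω => ENNReal.ofReal_lt_top)]
      refine integral_congr_ae (ae_of_all _ fun ω => ?_)
      simp only
      rw [ENNReal.toReal_ofReal (div_nonneg (h0 ω) hm0.le), ← Complex.ofReal_pow,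
        Real.sq_sqrt hm0.le, Complex.real_smul]
      have : (m : ℂ) ≠ 0 := by exact_mod_cast hm0.ne'
      push_cast
      field_simp

section TwoLevelBath

/-- The ground state of a two-level system. -/
noncomputable def groundState : EuclideanSpace ℂ (Fin 2) := EuclideanSpace.single 0 1

/-- The excited state of a two-level system. -/
noncomputable def excitedState : EuclideanSpace ℂ (Fin 2) := EuclideanSpace.single 1 1

theorem norm_groundState : ‖groundState‖ = 1 := by simp [groundState]

theorem inner_excitedState_self : inner ℂ excitedState excitedState = 1 := by simp [excitedState]

theorem inner_excitedState_groundState : inner ℂ excitedState groundState = 0 := by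
  simp [excitedState, groundState, EuclideanSpace.inner_single_left]

theorem inner_groundState_excitedState : inner ℂ groundState excitedState = 0 := by
  simp [excitedState, groundState, EuclideanSpace.inner_single_left]

/-- The coupling `z |1⟩⟨0| + z̄ |0⟩⟨1|`. -/
noncomputable def twoLevelCoupling (z : ℂ) :
    EuclideanSpace ℂ (Fin 2) →L[ℂ] EuclideanSpace ℂ (Fin 2) :=
  z • rankOne ℂ excitedState groundState + star (z • rankOne ℂ excitedState groundState)

theorem twoLevelCoupling_groundState (z : ℂ) :
    twoLevelCoupling z groundState = z • excitedState := by
  simp [twoLevelCoupling, ContinuousLinearMap.star_eq_adjoint, norm_groundState,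
    inner_excitedState_groundState]

variable (P : Measure ℝ) [IsProbabilityMeasure P] (a : ℝ)

/-- A two-level system in its ground state, driven at a random frequency `ω` by the coupling
`B(t) = a (exp (-i ω t) |1⟩⟨0| + h.c.)`. -/
noncomputable def twoLevelBath : Bath (EuclideanSpace ℂ (Fin 2)) P where
  ρ := rankOne ℂ groundState groundState
  B t ω := (twoLevelCoupling (a * Complex.exp (-(Complex.I * ω * t))) :
    EuclideanSpace ℂ (Fin 2) →ₗ[ℂ] EuclideanSpace ℂ (Fin 2)).toPMap ⊤
  density := isDensityOperator_rankOne_self norm_groundState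
  selfAdjoint t ω := isSelfAdjoint_toPMap_top (IsSelfAdjoint.add_star_self _)
  mem_domain t := ae_of_all _ fun ω x => by simp
  measurable t x := by
    simp only [pmapApply_toPMap_top, sqrt_rankOne_self norm_groundState, rankOne_apply, map_smul,
      ContinuousLinearMap.coe_coe, twoLevelCoupling_groundState]
    exact Continuous.aestronglyMeasurable (by fun_prop)
  secondMoment t := by
    simp only [pmapApply_toPMap_top, sqrtVec_rankOne_self norm_groundState, map_smul,
      ContinuousLinearMap.coe_coe, twoLevelCoupling_groundState]
    simp only [tsum_enorm_inner_smul_sq norm_groundState]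
    have hn : ∀ ω : ℝ, ‖((a : ℂ) * Complex.exp (-(Complex.I * ω * t))) • excitedState‖ₑ =
        ‖(a : ℂ) • excitedState‖ₑ := fun ω => by
      rw [enorm_smul, enorm_smul, enorm_mul,
        show -(Complex.I * ω * t) = ((-(ω * t) : ℝ) : ℂ) * Complex.I by push_cast; ring,
        ← ofReal_norm (Complex.exp _), Complex.norm_exp_ofReal_mul_I, ENNReal.ofReal_one, mul_one]
    simp only [hn, lintegral_const, measure_univ, mul_one]
    exact ENNReal.pow_lt_top enorm_lt_top

/-- The coupling sends the ground state to `a exp (-i ω t)` times the excited state, and the inner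
product conjugates the first phase. -/
theorem twoLevelBath_corr (t t' : ℝ) :
    (twoLevelBath P a).corr t t' =
      ∫ ω : ℝ, (a : ℂ) ^ 2 * Complex.exp (Complex.I * ω * ((t - t' : ℝ) : ℂ)) ∂P := by
  simp only [Bath.corr, twoLevelBath, pmapApply_toPMap_top,
    sqrtVec_rankOne_self norm_groundState, map_smul, ContinuousLinearMap.coe_coe,
    twoLevelCoupling_groundState]
  simp only [tsum_inner_smul_inner_smul norm_groundState]
  refine integral_congr_ae (ae_of_all _ fun ω => ?_)
  simp only [inner_smul_left, inner_smul_right, inner_excitedState_self, mul_one, map_mul,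
    Complex.conj_ofReal, ← Complex.exp_conj]
  rw [mul_mul_mul_comm, ← Complex.exp_add, ← sq]
  congr 2
  simp
  ring

/-- The coupling maps the ground state into its orthogonal complement. -/
theorem twoLevelBath_mean (t : ℝ) : (twoLevelBath P a).mean t = 0 := by
  simp only [Bath.mean, twoLevelBath, pmapApply_toPMap_top,
    sqrtVec_rankOne_self norm_groundState, map_smul, ContinuousLinearMap.coe_coe,
    twoLevelCoupling_groundState]
  simp only [tsum_inner_smul_inner_smul norm_groundState]
  simp [inner_groundState_excitedState]

end TwoLevelBath

/-! ### Realisation of prescribed spectra -/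

/-- Every nonnegative integrable spectral density is realised by a centred stationary bath. -/
theorem exists_bath_of_density {h : ℝ → ℝ} (hh : Integrable h volume) (h0 : ∀ ω, 0 ≤ h ω) :
    ∃ (P : Measure ℝ) (_ : IsProbabilityMeasure P) (b : Bath (EuclideanSpace ℂ (Fin 2)) P),
      b.IsWideSenseStationary ∧ (∀ t, b.mean t = 0) ∧
      ∀ t t', b.corr t t' = ∫ ω : ℝ, Complex.exp (Complex.I * ω * ((t - t' : ℝ) : ℂ)) * h ω := by
  obtain ⟨P, hP, a, ha⟩ := exists_probabilityMeasure_density hh h0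
  have hcorr : ∀ t t', (twoLevelBath P a).corr t t' =
      ∫ ω : ℝ, Complex.exp (Complex.I * ω * ((t - t' : ℝ) : ℂ)) * h ω := fun t t' => by
    rw [twoLevelBath_corr, ha]
  refine ⟨P, hP, twoLevelBath P a, ⟨fun t => ?_, fun t t' => ?_⟩, twoLevelBath_mean P a, hcorr⟩
  · rw [twoLevelBath_mean, twoLevelBath_mean]
  · rw [hcorr, hcorr, sub_zero]

/-- Reflecting the frequency in a Fourier integral. -/
theorem integral_exp_neg_time_mul (h : ℝ → ℝ) (t : ℝ) :
    ∫ ω : ℝ, Complex.exp (Complex.I * ω * ((-t : ℝ) : ℂ)) * h ω =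
      ∫ ω : ℝ, Complex.exp (Complex.I * ω * t) * h (-ω) := by
  rw [← integral_neg_eq_self]
  refine integral_congr_ae (ae_of_all _ fun ω => ?_)
  simp

theorem exists_bath_of_spectra {Sp Sm : ℝ → ℝ} {cp cm : ℝ → ℂ}
    (hSp : ∀ ω, Sp (-ω) = Sp ω) (hSm : ∀ ω, Sm (-ω) = -Sm ω) (hle : ∀ ω, |Sm ω| ≤ Sp ω)
    (hcp : HasFourierInv (fun ω => (Sp ω : ℂ)) cp)
    (hcm : HasFourierInv (fun ω => (Sm ω : ℂ)) cm) :
    ∃ (P : Measure ℝ) (_ : IsProbabilityMeasure P) (b : Bath (EuclideanSpace ℂ (Fin 2)) P),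
      b.IsWideSenseStationary ∧ (∀ t, b.mean t = 0) ∧
      (∀ t, b.anticommCorr t 0 = cp t) ∧ (∀ t, b.commCorr t 0 = cm t) ∧
      HasTemperedFourier (fun t => b.anticommCorr t 0) (fun ω => (Sp ω : ℂ)) ∧
      HasTemperedFourier (fun t => b.commCorr t 0) (fun ω => (Sm ω : ℂ)) ∧
      (Integrable (fun t => b.anticommCorr t 0) → Continuous Sp →
        HasFourier (fun t => b.anticommCorr t 0) (fun ω => (Sp ω : ℂ))) ∧
      (Integrable (fun t => b.commCorr t 0) → Continuous Sm →
        HasFourier (fun t => b.commCorr t 0) (fun ω => (Sm ω : ℂ))) := by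
  have hip : Integrable Sp volume := hcp.integrable fun ω => (abs_nonneg _).trans (hle ω)
  have him : Integrable Sm volume := by
    refine hip.mono' ?_ (ae_of_all _ hle)
    simpa using Complex.continuous_re.comp_aestronglyMeasurable
      hcm.locallyIntegrable.aestronglyMeasurable
  have hcp' := hcp.eq_integral hip.ofReal
  have hcm' := hcm.eq_integral him.ofReal
  -- Half of `S⁺ + S⁻`, divided by the `2π` of the inverse transform; nonnegative because `|S⁻| ≤
  -- S⁺`.
  have hi : Integrable (fun ω => (Sp ω + Sm ω) / (4 * Real.pi)) volume := (hip.add him).div_const _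
  obtain ⟨P, hP, b, hb, hmean, hcorr⟩ := exists_bath_of_density hi fun ω =>
    div_nonneg (by linarith [neg_abs_le (Sm ω), hle ω]) (by positivity)
  have hpi : (Real.pi : ℂ) ≠ 0 := by simp [Real.pi_ne_zero]
  have hint : ∀ t : ℝ, Integrable (fun ω : ℝ => Complex.exp (Complex.I * ω * t) *
      (((Sp ω + Sm ω) / (4 * Real.pi) : ℝ) : ℂ)) volume := fun t => integrable_exp_mul hi.ofReal t
  have hint' : ∀ t : ℝ, Integrable (fun ω : ℝ => Complex.exp (Complex.I * ω * t) *
      (((Sp (-ω) + Sm (-ω)) / (4 * Real.pi) : ℝ) : ℂ)) volume := fun t =>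
    integrable_exp_mul hi.comp_neg.ofReal t
  -- Exchanging the two times reflects `ω` in the density `h`, and by parity `h ω ± h (-ω)` equals
  -- `S⁺ / 2π` and `S⁻ / 2π` respectively.
  have hanti : ∀ t, b.anticommCorr t 0 = cp t := fun t => by
    rw [Bath.anticommCorr, hcorr, hcorr, sub_zero, zero_sub, integral_exp_neg_time_mul,
      ← integral_add (hint t) (hint' t), hcp', ← integral_const_mul]
    refine integral_congr_ae (ae_of_all _ fun ω => ?_)
    simp only [hSp, hSm]
    push_cast
    field_simp
    ring
  have hcomm : ∀ t, b.commCorr t 0 = cm t := fun t => by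
    rw [Bath.commCorr, hcorr, hcorr, sub_zero, zero_sub, integral_exp_neg_time_mul,
      ← integral_sub (hint t) (hint' t), hcm', ← integral_const_mul]
    refine integral_congr_ae (ae_of_all _ fun ω => ?_)
    simp only [hSp, hSm]
    push_cast
    field_simp
    ring
  refine ⟨P, hP, b, hb, hmean, hanti, hcomm, ?_⟩
  rw [funext hanti, funext hcomm]
  exact ⟨hasTemperedFourier_of_integrable hip.ofReal hcp',
    hasTemperedFourier_of_integrable him.ofReal hcm',
    fun hc hS => hasFourier_of_integrable hip.ofReal (Complex.continuous_ofReal.comp hS) hcp' hc,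
    fun hc hS => hasFourier_of_integrable him.ofReal (Complex.continuous_ofReal.comp hS) hcm' hc⟩

theorem theorem1 :
    -- any wide-sense stationary bath whose spectra exist
    (∀ {H : Type*} [NormedAddCommGroup H] [InnerProductSpace ℂ H] [CompleteSpace H]
      {Ω : Type*} [MeasurableSpace Ω] (P : Measure Ω) [IsProbabilityMeasure P]
      (b : Bath H P) (_ : b.IsWideSenseStationary) (Sp Sm : ℝ → ℂ)
      (_ : HasFourier (fun t => b.anticommCorr t 0) Sp)
      (_ : HasFourier (fun t => b.commCorr t 0) Sm),
      -- pointwise bound between the (real) spectra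
      (∀ ω : ℝ, (Sm ω).im = 0 ∧ ((‖Sm ω‖ : ℝ) : ℂ) ≤ Sp ω) ∧
      -- first corollary
      (∀ t t' : ℝ, ((‖b.commCorr t t'‖ : ℝ) : ℂ) ≤ b.anticommCorr 0 0) ∧
      -- second corollary
      (∀ T₁ T₂ : ℝ, 0 ≤ T₁ → 0 ≤ T₂ →
        ((2 * ‖∫ t in T₁..(T₁ + T₂), ∫ t' in (0 : ℝ)..T₁, b.commCorr t t'‖ : ℝ) : ℂ) ≤
          (∫ t in (0 : ℝ)..T₁, ∫ t' in (0 : ℝ)..T₁, b.anticommCorr t t') +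
          (∫ t in (0 : ℝ)..T₂, ∫ t' in (0 : ℝ)..T₂, b.anticommCorr t t'))) ∧
    -- converse
    (∀ (Sp Sm : ℝ → ℝ) (cp cm : ℝ → ℂ),
      (∀ ω, Sp (-ω) = Sp ω) → (∀ ω, Sm (-ω) = -Sm ω) → (∀ ω, |Sm ω| ≤ Sp ω) →
      HasFourierInv (fun ω => (Sp ω : ℂ)) cp → HasFourierInv (fun ω => (Sm ω : ℂ)) cm →
      ∃ (H : Type) (_ : NormedAddCommGroup H) (_ : InnerProductSpace ℂ H) (_ : CompleteSpace H)
        (Ω : Type) (_ : MeasurableSpace Ω) (P : Measure Ω) (_ : IsProbabilityMeasure P)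
        (b : Bath H P),
        b.IsWideSenseStationary ∧ (∀ t, b.mean t = 0) ∧
        -- the correlation functions are the inverse Fourier transforms of the given spectra
        (∀ t, b.anticommCorr t 0 = cp t) ∧ (∀ t, b.commCorr t 0 = cm t) ∧
        -- so their Fourier transforms are the given spectra
        HasTemperedFourier (fun t => b.anticommCorr t 0) (fun ω => (Sp ω : ℂ)) ∧
        HasTemperedFourier (fun t => b.commCorr t 0) (fun ω => (Sm ω : ℂ)) ∧
        (Integrable (fun t => b.anticommCorr t 0) → Continuous Sp →
          HasFourier (fun t => b.anticommCorr t 0) (fun ω => (Sp ω : ℂ))) ∧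
        (Integrable (fun t => b.commCorr t 0) → Continuous Sm →
          HasFourier (fun t => b.commCorr t 0) (fun ω => (Sm ω : ℂ)))) := by
  refine ⟨?_, ?_⟩
  · intro H _ _ _ Ω _ P _ b hb Sp Sm hp hm
    exact ⟨hb.abs_spectrum_le hp hm, hb.norm_commCorr_le, fun T₁ T₂ h₁ h₂ =>
      hb.norm_integral_commCorr_le
        (Bath.locallyIntegrable_corr hp.locallyIntegrable hm.locallyIntegrable) h₁ h₂⟩
  · intro Sp Sm cp cm hSp hSm hle hcp hcm
    obtain ⟨P, hP, b, hb⟩ := exists_bath_of_spectra hSp hSm hle hcp hcm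
    exact ⟨EuclideanSpace ℂ (Fin 2), inferInstance, inferInstance, inferInstance, ℝ, inferInstance,
      P, hP, b, hb⟩
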